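/- For $n,m\in\mathbb{N}^+$ let $h:[n]\to[m]$ be uniformly random and, independently, let $\sigma$ be uniformly random in $\{-1,1\}^n$. Let $A$ be the random $m\times n$ feature hashing matrix with entries $a_{ij}=\sigma_j$ if $h(j)=i$ and $a_{ij}=0$ otherwise. For $x\in\mathbb{R}^n$ let $X(x)=\left|\|Ax\|_2^2-\|x\|_2^2\right|$, and for a real random variable $Y$ and $r>0$ let $\|Y\|_r=\left(\mathbb{E}|Y|^r\right)^{1/r}$. For real $m,r,k>0$ let $$\Lambda(m,r,k)=\begin{cases}\sqrt{\frac rm}, & k\ge mr,\\[2pt] \max\left\{\sqrt{\frac rm},\ \frac{r^2}{k\ln^2\left(\frac{emr}{k}\right)}\right\}, & mr>k\ge\sqrt{mr},\\[2pt] \max\left\{\sqrt{\frac rm},\ \frac{r^2}{k\ln^2\left(\frac{emr}{k}\right)},\ \frac{r}{k\ln\left(\frac{emr}{k^2}\right)}\right\}, & \sqrt{mr}>k.\end{cases}$$ Then there is an absolute constant $C>0$ such that for all positive integers $m,n$, every even integer $r$ with $0<r\le m/4$, and every $x\in\mathbb{R}^n$ with $\|x\|_2=1$, $$\|X(x)\|_r\le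 C\cdot\Lambda\left(m,r,\|x\|_\infty^{-2}\right).$$ -/

import Mathlib

open MeasureTheory ProbabilityTheory

noncomputable section

namespace FeatureHashing

/-- Mathlib's measurable structure on `ℤˣ = {1, -1}` is the discrete one. -/
instance : MeasurableSingletonClass ℤˣ where
  measurableSet_singleton a :=
    ⟨{(a : ℤ)}, measurableSet_singleton _, by ext b; simp [Units.ext_iff]⟩

/-- The sample space of feature hashing: a hash function `h : [n] → [m]` together with a sign
vector `σ ∈ {-1, 1}ⁿ` (the group `ℤˣ` is exactly `{1, -1}`). -/
abbrev Sample (m n : ℕ) : Type := (Fin n → Fin m) × (Fin n → ℤˣ)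

/-- The sampling distribution: `h` is uniform on all functions `[n] → [m]`, `σ` is uniform on
`{-1, 1}ⁿ`, and `h` and `σ` are independent. -/
def sampleMeasure (m n : ℕ) : Measure (Sample m n) :=
  (uniformOn (Set.univ : Set (Fin n → Fin m))).prod (uniformOn (Set.univ : Set (Fin n → ℤˣ)))

/-- The feature hashing matrix: `a i j = σ j` if `h j = i`, and `a i j = 0` otherwise. -/
def hashMatrix {m n : ℕ} (ω : Sample m n) : Matrix (Fin m) (Fin n) ℝ :=
  Matrix.of fun i j => if ω.1 j = i then ((ω.2 j : ℤ) : ℝ) else 0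

/-- The random variable `X(x) = |‖A x‖₂² - ‖x‖₂²|`, both norms being Euclidean. -/
def distortion {m n : ℕ} (x : EuclideanSpace ℝ (Fin n)) (ω : Sample m n) : ℝ :=
  |‖WithLp.toLp 2 ((hashMatrix ω).mulVec x.ofLp)‖ ^ 2 - ‖x‖ ^ 2|

/-- The `r`-th moment norm `‖X‖_r = (E |X|^r)^(1/r)` of a real random variable, for `r > 0`. -/
def momentNorm {Ω : Type*} [MeasurableSpace Ω] (μ : Measure Ω) (X : Ω → ℝ) (r : ℝ) : ℝ :=
  (∫ ω, |X ω| ^ r ∂μ) ^ (1 / r)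

/-- The norm `‖x‖_∞ = max_j |x_j|` (the norm of the plain function space `Fin n → ℝ`). -/
def supNorm {n : ℕ} (x : EuclideanSpace ℝ (Fin n)) : ℝ := ‖x.ofLp‖

/-- The three-regime bound `Λ(m, r, k)`, for real `m, r, k > 0`. -/
def Lam (m r k : ℝ) : ℝ :=
  if m * r ≤ k then
    √(r / m)
  else if √(m * r) ≤ k then
    max (√(r / m)) (r ^ 2 / (k * Real.log (Real.exp 1 * m * r / k) ^ 2))
  else
    max (√(r / m)) (max (r ^ 2 / (k * Real.log (Real.exp 1 * m * r / k) ^ 2))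
      (r / (k * Real.log (Real.exp 1 * m * r / k ^ 2))))

end FeatureHashing

end

/-! ### The numerical inequality in `T = r / Λ` that the moment bound needs. -/

namespace FeatureHashing

/-! The diagonal terms of `‖Ax‖²` sum to `‖x‖²`, so the signed distortion is a sum over buckets of
the off-diagonal sums `Z_b = ∑_{i≠j} a_bi x_i a_bj x_j`. As `r` is even, the absolute value
disappears and `E (∑ Z_b)^r` can be expanded multinomially. Buckets compete for coordinates, so `E ∏
Z_b^κ_b` is at most the product of the single-bucket moments `M_κ_b` (`sum_prod_offDiag_pow_le`). An
exponential generating function then bounds the whole sum by `r! t^(-r) (∑ t^d M_d / d!)^m` for any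
`t > 0` (`sum_multinomial_le`).

It remains to show `M_d ≤ (36 e d / T)^d r / m` with `T = r / Λ` (`bucketMoment_le`). Expand `M_d`
over sequences of `d` pairs and group them by the set `V` of coordinates used. Only even
multiplicities survive, so `2 ≤ |V| ≤ d`. With `v = |V|`, there are at most `v^(2d)` sequences, each
contributing at most `k^(-d) ∏_V k x_j² / m`. By `support_bound` the total for `V` is at most `(36 d
/ T)^d (r / m) ∏_V d x_j²`, and summing over `V` gives `∏ (1 + d x_j²) ≤ e^d`.

`support_bound` is where the terms of `Λ` enter: the third controls `v = 2`, the second controls `v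
≥ 3` with `T v > k`, and `√(r / m)` controls `T v ≤ k`. -/

theorem div_pow_le_exp {x : ℝ} (hx : 0 ≤ x) {d : ℕ} (hd : 0 < d) :
    (x / d) ^ d ≤ Real.exp x := by
  have hd' : (0 : ℝ) < d := by exact_mod_cast hd
  calc (x / d) ^ d ≤ (Real.exp (x / d)) ^ d := by
        gcongr
        linarith [Real.add_one_le_exp (x / d)]
    _ = Real.exp x := by
        rw [← Real.exp_nat_mul]
        congr 1
        field_simp

theorem support_two_bound {T m r k : ℝ} {d : ℕ} (hT : 0 < T) (hm : 0 < m) (hr : 0 < r)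
    (hk : 0 < k) (hTm : T ^ 2 ≤ r * m)
    (h3 : k < √(m * r) → T ≤ k * Real.log (Real.exp 1 * m * r / k ^ 2)) (hd : 2 ≤ d) :
    (T * 2 ^ 2 / (d * k)) ^ d ≤ 36 ^ d * (r / m) * (m * 2 / k) ^ 2 := by
  have hd' : (2 : ℝ) ≤ d := by exact_mod_cast hd
  have hd0 : (0 : ℝ) < d := by linarith
  have hR : 36 ^ d * (r / m) * (m * 2 / k) ^ 2 = 36 ^ d * (4 * (r * m / k ^ 2)) := by
    field_simp; ring
  have hq : 0 < r * m / k ^ 2 := by positivity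
  rw [hR]
  by_cases h : k < √(m * r)
  · have hl := h3 h
    have hkk : k ^ 2 < m * r := (Real.lt_sqrt hk.le).1 h
    have hlog : 0 ≤ Real.log (Real.exp 1 * m * r / k ^ 2) := by
      apply Real.log_nonneg
      rw [le_div_iff₀ (by positivity)]
      have := Real.add_one_le_exp (1 : ℝ)
      nlinarith
    have he : Real.exp 1 * m * r / k ^ 2 = Real.exp 1 * (r * m / k ^ 2) := by ring
    calc (T * 2 ^ 2 / (d * k)) ^ d
        ≤ (4 * (Real.log (Real.exp 1 * m * r / k ^ 2) / d)) ^ d := by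
          gcongr
          rw [div_le_iff₀ (by positivity)]
          have : 4 * (Real.log (Real.exp 1 * m * r / k ^ 2) / d) * (d * k)
            = 4 * (k * Real.log (Real.exp 1 * m * r / k ^ 2)) := by field_simp
          rw [this]; linarith
      _ = 4 ^ d * (Real.log (Real.exp 1 * m * r / k ^ 2) / d) ^ d := mul_pow ..
      _ ≤ 36 ^ d * (4 * (r * m / k ^ 2)) := by
          gcongr
          · norm_num
          -- `(L / d)^d ≤ e^L` turns the logarithm back into its argument `e m r / k²`, uniformly in
          -- `d`.
          · refine (div_pow_le_exp hlog (by omega)).trans ?_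
            rw [Real.exp_log (by positivity), he]
            have := Real.exp_one_lt_d9
            gcongr
            linarith
  · push Not at h
    have hkk : m * r ≤ k ^ 2 := (Real.sqrt_le_left hk.le).1 h
    have hTk : T ≤ k := by
      apply le_of_sq_le_sq _ hk.le
      linarith
    calc (T * 2 ^ 2 / (d * k)) ^ d ≤ (2 * (T / k)) ^ d := by
          gcongr
          rw [div_le_iff₀ (by positivity)]
          have : 2 * (T / k) * (d * k) = 2 * T * d := by field_simp
          rw [this]
          nlinarith
      _ = 2 ^ d * (T / k) ^ d := mul_pow ..
      _ ≤ 36 ^ d * (4 * (r * m / k ^ 2)) := by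
          gcongr
          · norm_num
          · calc (T / k) ^ d ≤ (T / k) ^ 2 :=
                pow_le_pow_of_le_one (by positivity) ((div_le_one hk).2 hTk) hd
              _ = T ^ 2 / k ^ 2 := div_pow ..
              _ ≤ r * m / k ^ 2 := by gcongr
              _ ≤ 4 * (r * m / k ^ 2) := by linarith

theorem support_bound_of_mul_le {T m r k : ℝ} {v d : ℕ} (hT : 0 < T) (hm : 0 < m)
    (hr : 0 < r) (hk : 0 < k) (hrm : r ≤ m) (hTm : T ^ 2 ≤ r * m) (hv : 2 ≤ v) (hvd : v ≤ d)
    (hTv : T * v ≤ k) :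
    (T * v ^ 2 / (d * k)) ^ d ≤ 36 ^ d * (r / m) * (m * v / k) ^ v := by
  have hv0 : (0 : ℝ) < v := by exact_mod_cast (by omega : 0 < v)
  have hvd' : (v : ℝ) ≤ d := by exact_mod_cast hvd
  have hd0 : (0 : ℝ) < d := by linarith
  have hTm' : T ≤ m := by
    apply le_of_sq_le_sq _ hm.le
    nlinarith
  calc (T * v ^ 2 / (d * k)) ^ d ≤ (T * v / k) ^ d := by
        gcongr ?_ ^ d
        rw [div_le_div_iff₀ (by positivity) hk]
        have : 0 < T * v * k := by positivity
        nlinarith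
    _ ≤ (T * v / k) ^ v :=
        pow_le_pow_of_le_one (by positivity) ((div_le_one hk).2 hTv) hvd
    _ = (T / m) ^ v * (m * v / k) ^ v := by
        rw [← mul_pow]; congr 1; field_simp
    _ ≤ (36 ^ d * (r / m)) * (m * v / k) ^ v := by
        gcongr
        calc (T / m) ^ v ≤ (T / m) ^ 2 :=
              pow_le_pow_of_le_one (by positivity) ((div_le_one hm).2 hTm') hv
          _ = T ^ 2 / m ^ 2 := div_pow ..
          _ ≤ r * m / m ^ 2 := by gcongr
          _ = 1 * (r / m) := by field_simp
          _ ≤ 36 ^ d * (r / m) := by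
              gcongr
              exact one_le_pow₀ (by norm_num)

/-- Expanding the right side gives `a² w² / δ + 12 a w² + 36 w² δ`, which dominates `a² + 4 a w + 4
w²` term by term. -/
theorem add_sq_le_mul_sq {a w δ : ℝ} (ha : 0 ≤ a) (hw : 1 ≤ w) (hδ : 1 ≤ δ)
    (hδw : δ ≤ w ^ 2) : (2 * w + a) ^ 2 ≤ 36 * (a / (6 * δ) + 1) ^ 2 * (w ^ 2 * δ) := by
  have hδ0 : 0 < δ := by linarith
  have e : 36 * (a / (6 * δ) + 1) ^ 2 * (w ^ 2 * δ)
      = a ^ 2 * (w ^ 2 / δ) + 12 * (a * w ^ 2) + 36 * (w ^ 2 * δ) := by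
    field_simp
    ring
  have h : 1 ≤ w ^ 2 / δ := (one_le_div hδ0).2 hδw
  have h1 : a ^ 2 * 1 ≤ a ^ 2 * (w ^ 2 / δ) := by gcongr
  have h2 : a * w ≤ a * w ^ 2 := by
    gcongr
    nlinarith
  have h3 : w ^ 2 * 1 ≤ w ^ 2 * δ := by gcongr
  have h4 : 0 ≤ a * w ^ 2 := by positivity
  have e2 : (2 * w + a) ^ 2 = 4 * w ^ 2 + 4 * (a * w) + a ^ 2 := by ring
  have h5 := sq_nonneg w
  rw [e, e2]
  linarith

/-- Two of the `v` factors `p = m v / k` pay for `m / r`; since `v ≥ 3`, at least `p^(v/3)` is left.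
That surplus, spread over `d` factors, absorbs the squared logarithm. -/
theorem support_bound_of_lt_mul {T m r k : ℝ} {v d : ℕ} (hT : 0 < T) (hm : 0 < m)
    (hr : 0 < r) (hk : 0 < k) (hrm : r ≤ m) (hTm : T ^ 2 ≤ r * m)
    (h2 : k < m * r → T * r ≤ k * Real.log (Real.exp 1 * m * r / k) ^ 2)
    (hv : 3 ≤ v) (hvd : v ≤ d) (hdr : (d : ℝ) ≤ r) (hTv : k < T * v) :
    (T * v ^ 2 / (d * k)) ^ d ≤ 36 ^ d * (r / m) * (m * v / k) ^ v := by
  have hv3 : (3 : ℝ) ≤ v := by exact_mod_cast hv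
  have hv0 : (0 : ℝ) < v := by linarith
  have hvd' : (v : ℝ) ≤ d := by exact_mod_cast hvd
  have hd0 : (0 : ℝ) < d := by linarith
  have hTm' : T ≤ m := by
    apply le_of_sq_le_sq _ hm.le
    nlinarith
  have hl := h2 (hTv.trans_le (mul_le_mul hTm' (hvd'.trans hdr) hv0.le hm.le))
  set p := m * v / k with hp
  have hp0 : 0 < p := by positivity
  have hpT : m / T ≤ p := by
    rw [hp, div_le_div_iff₀ hT hk]
    nlinarith
  have hp1 : 1 ≤ p := ((one_le_div hT).2 hTm').trans hpT
  have hp2 : m / r ≤ p ^ 2 := by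
    calc m / r ≤ (m / T) ^ 2 := by
          rw [div_pow, div_le_div_iff₀ hr (by positivity)]
          nlinarith
      _ ≤ p ^ 2 := by gcongr
  have hlp : 0 ≤ Real.log p := Real.log_nonneg hp1
  have hR : Real.exp (v * Real.log p / 3) ≤ (r / m) * p ^ v := by
    calc Real.exp (v * Real.log p / 3) ≤ Real.exp ((v - 2 : ℕ) * Real.log p) := by
          apply Real.exp_le_exp.2
          rw [Nat.cast_sub (by omega)]
          push_cast
          nlinarith
      _ = p ^ (v - 2) := by rw [Real.exp_nat_mul, Real.exp_log hp0]
      _ = (r / m) * ((m / r) * p ^ (v - 2)) := by field_simp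
      _ ≤ (r / m) * (p ^ 2 * p ^ (v - 2)) := by gcongr
      _ = (r / m) * p ^ v := by rw [← pow_add]; congr 2; omega
  set w := √(r / v) with hw
  have hrv : 1 ≤ r / v := (one_le_div hv0).2 (hvd'.trans hdr)
  have hw2 : w ^ 2 = r / v := Real.sq_sqrt (by positivity)
  have hw1 : 1 ≤ w := Real.one_le_sqrt.2 hrv
  -- Since `e m r / k = e p w²`, the logarithm is `1 + log p + 2 log w`, and `log w ≤ w - 1`.
  have hlog : Real.log (Real.exp 1 * m * r / k) ≤ 2 * w + Real.log p := by
    have e : Real.exp 1 * m * r / k = Real.exp 1 * (p * w ^ 2) := by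
      rw [hw2, hp]; field_simp
    rw [e, Real.log_mul (by positivity) (by positivity), Real.log_mul (by positivity) (by positivity),
      Real.log_pow, Real.log_exp]
    have := Real.log_le_sub_one_of_pos (by linarith : 0 < w)
    push_cast
    linarith
  have hlog0 : 0 ≤ Real.log (Real.exp 1 * m * r / k) := by
    have e : Real.exp 1 * m * r / k = Real.exp 1 * (p * w ^ 2) := by
      rw [hw2, hp]; field_simp
    rw [e]
    apply Real.log_nonneg
    have := Real.add_one_le_exp (1 : ℝ)
    have : 1 ≤ p * w ^ 2 := one_le_mul_of_one_le_of_one_le hp1 (one_le_pow₀ hw1)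
    nlinarith
  have hbase : T * v ^ 2 / (d * k) ≤ 36 * Real.exp (v * Real.log p / (3 * d)) := by
    have hδ : 1 ≤ (d : ℝ) / v := (one_le_div hv0).2 hvd'
    have hδρ : (d : ℝ) / v ≤ w ^ 2 := by rw [hw2]; gcongr
    calc T * v ^ 2 / (d * k) = (T * r) * v ^ 2 / (d * k * r) := by field_simp
      _ ≤ (k * Real.log (Real.exp 1 * m * r / k) ^ 2) * v ^ 2 / (d * k * r) := by gcongr
      _ = Real.log (Real.exp 1 * m * r / k) ^ 2 / (w ^ 2 * (d / v)) := by
          rw [hw2]; field_simp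
      _ ≤ (2 * w + Real.log p) ^ 2 / (w ^ 2 * (d / v)) := by gcongr
      _ ≤ 36 * (v * Real.log p / (6 * d) + 1) ^ 2 := by
          set δ := (d : ℝ) / v with hδe
          have e : v * Real.log p / (6 * d) = Real.log p / (6 * δ) := by
            rw [hδe]; field_simp
          rw [e, div_le_iff₀ (by positivity)]
          exact add_sq_le_mul_sq hlp hw1 hδ hδρ
      _ ≤ 36 * (Real.exp (v * Real.log p / (6 * d))) ^ 2 := by
          gcongr
          exact Real.add_one_le_exp _
      _ = 36 * Real.exp (v * Real.log p / (3 * d)) := by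
          rw [← Real.exp_nat_mul]; congr 2; push_cast; field_simp; ring
  calc (T * v ^ 2 / (d * k)) ^ d ≤ (36 * Real.exp (v * Real.log p / (3 * d))) ^ d := by gcongr
    _ = 36 ^ d * Real.exp (v * Real.log p / 3) := by
        rw [mul_pow, ← Real.exp_nat_mul]; congr 2; field_simp
    _ ≤ 36 ^ d * ((r / m) * p ^ v) := by gcongr
    _ = _ := by ring

theorem support_bound {T m r k : ℝ} {v d : ℕ} (hT : 0 < T) (hm : 0 < m)
    (hr : 0 < r) (hk : 0 < k) (hrm : r ≤ m) (hTm : T ^ 2 ≤ r * m)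
    (h2 : k < m * r → T * r ≤ k * Real.log (Real.exp 1 * m * r / k) ^ 2)
    (h3 : k < √(m * r) → T ≤ k * Real.log (Real.exp 1 * m * r / k ^ 2))
    (hv : 2 ≤ v) (hvd : v ≤ d) (hdr : (d : ℝ) ≤ r) :
    (T * v ^ 2 / (d * k)) ^ d ≤ 36 ^ d * (r / m) * (m * v / k) ^ v := by
  rcases hv.eq_or_lt with rfl | hv3
  · simpa using support_two_bound hT hm hr hk hTm h3 hvd
  · rcases le_or_gt (T * v) k with h | h
    · exact support_bound_of_mul_le hT hm hr hk hrm hTm hv hvd h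
    · exact support_bound_of_lt_mul hT hm hr hk hrm hTm h2 hv3 hvd hdr h

/-- `r / Λ` satisfies each of the three constraints that define `Λ`. -/
theorem Lam_bounds {m r k : ℝ} (hm : 0 < m) (hr : 0 < r) (hk : 0 < k) :
    0 < Lam m r k ∧ (r / Lam m r k) ^ 2 ≤ r * m ∧
    (k < m * r → r / Lam m r k * r ≤ k * Real.log (Real.exp 1 * m * r / k) ^ 2) ∧
    (k < √(m * r) → r ≤ m → 1 ≤ r →
      r / Lam m r k ≤ k * Real.log (Real.exp 1 * m * r / k ^ 2)) := by
  have hs : 0 < √(r / m) := by positivity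
  have h1 : √(r / m) ≤ Lam m r k := by
    unfold Lam; split_ifs <;> simp
  have hL := hs.trans_le h1
  refine ⟨hL, ?_, fun h => ?_, fun h hrm hr1 => ?_⟩
  · have h4 : r / m ≤ Lam m r k ^ 2 := by
      rw [← Real.sq_sqrt (by positivity : 0 ≤ r / m)]; gcongr
    rw [div_pow, div_le_iff₀ (by positivity)]
    calc r ^ 2 = r * m * (r / m) := by field_simp
      _ ≤ _ := by gcongr
  · have hlog : 0 < Real.log (Real.exp 1 * m * r / k) := by
      apply Real.log_pos
      rw [one_lt_div hk]
      have := Real.add_one_le_exp (1 : ℝ)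
      nlinarith
    have h4 : r ^ 2 / (k * Real.log (Real.exp 1 * m * r / k) ^ 2) ≤ Lam m r k := by
      unfold Lam
      rw [if_neg (not_le.2 h)]
      split_ifs <;> simp
    rw [div_le_iff₀ (by positivity)] at h4
    rw [div_mul_eq_mul_div, div_le_iff₀ hL]
    linarith
  · have hk2 : k ^ 2 < m * r := (Real.lt_sqrt hk.le).1 h
    have hmr : 1 ≤ m * r := by nlinarith
    -- Needed so that `k < √(m r)` also excludes the first branch of `Λ`.
    have hs1 : √(m * r) ≤ m * r := by
      rw [Real.sqrt_le_left (by positivity)]; nlinarith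
    have hlog : 0 < Real.log (Real.exp 1 * m * r / k ^ 2) := by
      apply Real.log_pos
      rw [one_lt_div (by positivity)]
      have := Real.add_one_le_exp (1 : ℝ)
      nlinarith
    have h4 : r / (k * Real.log (Real.exp 1 * m * r / k ^ 2)) ≤ Lam m r k := by
      unfold Lam
      rw [if_neg (not_le.2 (h.trans_le hs1)), if_neg (not_le.2 h)]
      simp
    rw [div_le_iff₀ (by positivity)] at h4
    rw [div_le_iff₀ hL]
    linarith

end FeatureHashing

/-! ### Multinomial expansion and reduction to single-bucket moments. -/

namespace FeatureHashing

open Finset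

/-- The `c`-th moment of `σ δ x`, with `σ` a uniform sign and `δ` an independent Bernoulli variable
of mean `1 / m`. -/
noncomputable def entryMoment (m : ℕ) (c : ℕ) (x : ℝ) : ℝ :=
  if c = 0 then 1 else if Even c then x ^ c / m else 0

theorem entryMoment_nonneg (m c : ℕ) (x : ℝ) : 0 ≤ entryMoment m c x := by
  unfold entryMoment
  split_ifs with h1 h2
  · exact zero_le_one
  · exact div_nonneg (h2.pow_nonneg x) (Nat.cast_nonneg m)
  · exact le_rfl

/-- The number of times `j` occurs as an endpoint in the sequence `f` of pairs. -/
def endpointCount {ι : Type*} [DecidableEq ι] {d : ℕ} (f : Fin d → ι × ι) (j : ι) : ℕ :=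
  ∑ t, ((if (f t).1 = j then 1 else 0) + (if (f t).2 = j then 1 else 0))

theorem prod_pairs_eq_prod_pow {ι : Type*} [DecidableEq ι] [Fintype ι] {d : ℕ}
    (f : Fin d → ι × ι) (u : ι → ℝ) :
    ∏ t, (u (f t).1 * u (f t).2) = ∏ j, u j ^ endpointCount f j := by
  simp only [endpointCount]
  simp_rw [← prod_pow_eq_pow_sum, pow_add]
  rw [prod_comm]
  refine prod_congr rfl fun t _ => ?_
  rw [prod_mul_distrib, prod_pow_boole, prod_pow_boole]
  simp

/-- The `d`-th moment of the off-diagonal part of the square of one bucket. -/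
noncomputable def bucketMoment (m : ℕ) {n : ℕ} (x : Fin n → ℝ) (d : ℕ) : ℝ :=
  ∑ f ∈ Fintype.piFinset (fun _ : Fin d => (univ : Finset (Fin n)).offDiag),
    ∏ j, entryMoment m (endpointCount f j) (x j)

theorem bucketMoment_nonneg (m : ℕ) {n : ℕ} (x : Fin n → ℝ) (d : ℕ) :
    0 ≤ bucketMoment m x d :=
  sum_nonneg fun _ _ => prod_nonneg fun _ _ => entryMoment_nonneg _ _ _

/-- A coordinate hashes to only one bucket, so positive exponents in two buckets force the sum to
vanish. Otherwise at most one factor matters and the sum is `2m`, the number of outcomes, times its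
moment. -/
theorem sum_entry_prod {m : ℕ} (hm : 0 < m) (c : Fin m → ℕ) (x : ℝ) :
    ∑ p : Fin m × ℤˣ, ∏ b, (if p.1 = b then ((p.2 : ℤ) : ℝ) * x else 0) ^ c b = 0 ∨
    ∑ p : Fin m × ℤˣ, ∏ b, (if p.1 = b then ((p.2 : ℤ) : ℝ) * x else 0) ^ c b
      = (2 * m) * ∏ b, entryMoment m (c b) x := by
  have hm' : (0 : ℝ) < m := by exact_mod_cast hm
  by_cases h0 : ∀ b, c b = 0
  · simp [h0, entryMoment, Fintype.card_prod, mul_comm]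
  · push Not at h0
    obtain ⟨b, hb⟩ := h0
    by_cases h1 : ∃ b', b' ≠ b ∧ c b' ≠ 0
    · obtain ⟨b', hbb', hb'⟩ := h1
      refine Or.inl (sum_eq_zero fun p _ => ?_)
      by_cases hp : p.1 = b
      · refine prod_eq_zero (mem_univ b') ?_
        rw [if_neg (by rw [hp]; exact hbb'.symm), zero_pow hb']
      · refine prod_eq_zero (mem_univ b) ?_
        rw [if_neg hp, zero_pow hb]
    · right
      push Not at h1
      have e1 : ∀ g : Fin m → ℝ, ∏ b', g b' ^ c b' = g b ^ c b := fun g =>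
        prod_eq_single b (fun b' _ h => by rw [h1 b' h, pow_zero]) (by simp)
      have e2 : ∏ b', entryMoment m (c b') x = entryMoment m (c b) x :=
        prod_eq_single b (fun b' _ h => by simp [h1 b' h, entryMoment]) (by simp)
      simp_rw [e1, e2]
      rw [Fintype.sum_prod_type, sum_eq_single b]
      · have hu : (univ : Finset ℤˣ) = {1, -1} := rfl
        rw [hu, sum_pair (by decide)]
        unfold entryMoment
        rw [if_neg hb]
        by_cases he : Even (c b)
        · simp [he, he.neg_pow]
          field_simp
          norm_num
        · simp [he, (Nat.not_even_iff_odd.1 he).neg_pow]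
      · intro a _ ha
        simp [ha, hb]
      · simp

/-- The entry `a i j * x j` of the hashed vector. -/
noncomputable def entry {m n : ℕ} (x : Fin n → ℝ) (ω : Sample m n) (b : Fin m) (j : Fin n) : ℝ :=
  if ω.1 j = b then ((ω.2 j : ℤ) : ℝ) * x j else 0

theorem sum_sample_prod {m n : ℕ} (g : Fin n → Fin m × ℤˣ → ℝ) :
    ∑ ω : Sample m n, ∏ j, g j (ω.1 j, ω.2 j) = ∏ j, ∑ p, g j p := by
  rw [prod_univ_sum, Fintype.piFinset_univ]
  exact ((Equiv.arrowProdEquivProdArrow (Fin n) (fun _ => Fin m) (fun _ => ℤˣ)).sum_comp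
    (fun ω : Sample m n => ∏ j, g j (ω.1 j, ω.2 j))).symm

theorem sum_prod_offDiag_pow_le {m n : ℕ} (hm : 0 < m) (x : Fin n → ℝ) (κ : Fin m → ℕ) :
    ∑ ω : Sample m n, ∏ b, (∑ p ∈ univ.offDiag, entry x ω b p.1 * entry x ω b p.2) ^ κ b
      ≤ (2 * m) ^ n * ∏ b, bucketMoment m x (κ b) := by
  simp_rw [sum_pow', bucketMoment]
  simp_rw [prod_univ_sum]
  rw [sum_comm, mul_sum]
  refine sum_le_sum fun f _ => ?_
  simp_rw [prod_pairs_eq_prod_pow]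
  calc ∑ ω : Sample m n, ∏ b, ∏ j, entry x ω b j ^ endpointCount (f b) j
      = ∑ ω : Sample m n, ∏ j, ∏ b, entry x ω b j ^ endpointCount (f b) j := by
        exact sum_congr rfl fun ω _ => prod_comm
    _ = ∏ j, ∑ p : Fin m × ℤˣ,
          ∏ b, (if p.1 = b then ((p.2 : ℤ) : ℝ) * x j else 0) ^ endpointCount (f b) j :=
        sum_sample_prod (fun j p =>
          ∏ b, (if p.1 = b then ((p.2 : ℤ) : ℝ) * x j else 0) ^ endpointCount (f b) j)
    _ ≤ ∏ j, (2 * m) * ∏ b, entryMoment m (endpointCount (f b) j) (x j) := by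
        have hnn : ∀ j, 0 ≤ (2 * m : ℝ) * ∏ b, entryMoment m (endpointCount (f b) j) (x j) :=
          fun j => mul_nonneg (by positivity) (prod_nonneg fun _ _ => entryMoment_nonneg _ _ _)
        refine prod_le_prod (fun j _ => ?_) fun j _ => ?_
        · rcases sum_entry_prod hm (fun b => endpointCount (f b) j) (x j) with h | h
          · exact h.ge
          · exact (hnn j).trans h.ge
        · rcases sum_entry_prod hm (fun b => endpointCount (f b) j) (x j) with h | h
          · exact h.trans_le (hnn j)
          · exact h.le
    _ = (2 * m) ^ n * ∏ b, ∏ j, entryMoment m (endpointCount (f b) j) (x j) := by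
        rw [prod_mul_distrib, prod_const, card_univ, Fintype.card_fin, prod_comm]

theorem sum_offDiag_pow_le {m n : ℕ} (hm : 0 < m) (x : Fin n → ℝ) (r : ℕ) :
    ∑ ω : Sample m n, (∑ b, ∑ p ∈ univ.offDiag, entry x ω b p.1 * entry x ω b p.2) ^ r
      ≤ (2 * m) ^ n * ∑ κ ∈ piAntidiag (univ : Finset (Fin m)) r,
        Nat.multinomial univ κ * ∏ b, bucketMoment m x (κ b) := by
  have e : ∀ ω : Sample m n,
      (∑ b, ∑ p ∈ univ.offDiag, entry x ω b p.1 * entry x ω b p.2) ^ r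
        = ∑ κ ∈ piAntidiag (univ : Finset (Fin m)) r, Nat.multinomial univ κ *
          ∏ b, (∑ p ∈ univ.offDiag, entry x ω b p.1 * entry x ω b p.2) ^ κ b :=
    fun ω => sum_pow_eq_sum_piAntidiag _ _ _
  simp_rw [e]
  rw [sum_comm, mul_sum]
  refine sum_le_sum fun κ _ => ?_
  rw [← mul_sum, mul_left_comm]
  gcongr
  exact sum_prod_offDiag_pow_le hm x κ

/-- The left side is `r! / t^r` times part of the expansion of the `m`-th power; the discarded terms
are nonnegative. -/
theorem sum_multinomial_le {m : ℕ} {M : ℕ → ℝ} (hM : ∀ d, 0 ≤ M d) {t : ℝ} (ht : 0 < t) (r : ℕ) :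
    ∑ κ ∈ piAntidiag (univ : Finset (Fin m)) r, Nat.multinomial univ κ * ∏ b, M (κ b)
      ≤ r.factorial / t ^ r * (∑ d ∈ range (r + 1), t ^ d * M d / d.factorial) ^ m := by
  have e : (∑ d ∈ range (r + 1), t ^ d * M d / d.factorial) ^ m
      = ∑ κ ∈ Fintype.piFinset (fun _ : Fin m => range (r + 1)),
        ∏ b, t ^ κ b * M (κ b) / (κ b).factorial := sum_pow' _ _ _
  rw [e, mul_sum]
  have hsub : piAntidiag (univ : Finset (Fin m)) r
      ⊆ Fintype.piFinset (fun _ : Fin m => range (r + 1)) := by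
    intro κ hκ
    rw [mem_piAntidiag] at hκ
    rw [Fintype.mem_piFinset]
    intro b
    rw [mem_range, Nat.lt_succ_iff, ← hκ.1]
    exact single_le_sum (fun _ _ => Nat.zero_le _) (mem_univ b)
  refine le_trans (sum_le_sum fun κ hκ => ?_) (sum_le_sum_of_subset_of_nonneg hsub fun κ _ _ =>
    mul_nonneg (by positivity) (prod_nonneg fun b _ => ?_))
  · rw [mem_piAntidiag] at hκ
    have hmul := Nat.multinomial_spec (univ : Finset (Fin m)) κ
    rw [hκ.1] at hmul
    have hmul' : (∏ b, ((κ b).factorial : ℝ)) * Nat.multinomial univ κ = r.factorial := by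
      exact_mod_cast hmul
    have hpos : (0 : ℝ) < ∏ b, ((κ b).factorial : ℝ) :=
      prod_pos fun b _ => by exact_mod_cast Nat.factorial_pos _
    rw [prod_div_distrib, prod_mul_distrib, prod_pow_eq_pow_sum, hκ.1, ← hmul']
    apply le_of_eq
    field_simp
  · have := hM (κ b)
    positivity

end FeatureHashing

/-! ### Bounding the moment of one bucket by vertex supports. -/

namespace FeatureHashing

open Finset

/-- One factor `x²` is kept as a weight for the later sum over supports; every other one is replaced
by its bound `1 / k`. -/
theorem entryMoment_le {m : ℕ} (hm : 0 < m) {k x : ℝ} (hk : 0 < k) (hx : x ^ 2 ≤ 1 / k)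
    {c : ℕ} (hc : c ≠ 0) (he : Even c) :
    entryMoment m c x ≤ k * x ^ 2 / m * (1 / k) ^ (c / 2) := by
  have hm' : (0 : ℝ) < m := by exact_mod_cast hm
  unfold entryMoment
  rw [if_neg hc, if_pos he]
  obtain ⟨a, rfl⟩ := he
  obtain ⟨a, rfl⟩ : ∃ b, a = b + 1 := ⟨a - 1, by omega⟩
  have e : (a + 1 + (a + 1)) / 2 = a + 1 := by omega
  rw [e]
  calc x ^ (a + 1 + (a + 1)) / m = x ^ 2 / m * (x ^ 2) ^ a := by
        rw [← pow_mul]; ring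
    _ ≤ x ^ 2 / m * (1 / k) ^ a := by gcongr
    _ = _ := by
        rw [pow_succ (1 / k)]
        field_simp

theorem sum_endpointCount {ι : Type*} [DecidableEq ι] [Fintype ι] {d : ℕ} (f : Fin d → ι × ι) :
    ∑ j, endpointCount f j = 2 * d := by
  unfold endpointCount
  rw [sum_comm]
  simp [sum_add_distrib]
  ring

theorem endpointCount_fst_ne_zero {ι : Type*} [DecidableEq ι] {d : ℕ} (f : Fin d → ι × ι)
    (t : Fin d) : endpointCount f (f t).1 ≠ 0 := by
  have := single_le_sum (f := fun s => (if (f s).1 = (f t).1 then 1 else 0)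
    + (if (f s).2 = (f t).1 then 1 else 0)) (fun _ _ => Nat.zero_le _) (mem_univ t)
  simp only [if_true] at this
  unfold endpointCount
  omega

theorem endpointCount_snd_ne_zero {ι : Type*} [DecidableEq ι] {d : ℕ} (f : Fin d → ι × ι)
    (t : Fin d) : endpointCount f (f t).2 ≠ 0 := by
  have := single_le_sum (f := fun s => (if (f s).1 = (f t).2 then 1 else 0)
    + (if (f s).2 = (f t).2 then 1 else 0)) (fun _ _ => Nat.zero_le _) (mem_univ t)
  simp only [if_true] at this
  unfold endpointCount
  omega

/-- The vertices that occur in the sequence `f` of pairs. -/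
def vertexSupport {ι : Type*} [DecidableEq ι] [Fintype ι] {d : ℕ} (f : Fin d → ι × ι) : Finset ι :=
  univ.filter fun j => endpointCount f j ≠ 0

/-- An odd multiplicity kills the product. Otherwise every vertex used has multiplicity at least 2
out of a total of `2d`, giving size at most `d`; off-diagonal pairs give at least two vertices. -/
theorem prod_entryMoment_le {m n d : ℕ} (hm : 0 < m) (hd : 0 < d) {k : ℝ} (hk : 0 < k)
    {x : Fin n → ℝ} (hx : ∀ j, x j ^ 2 ≤ 1 / k) {f : Fin d → Fin n × Fin n}
    (hf : f ∈ Fintype.piFinset (fun _ : Fin d => (univ : Finset (Fin n)).offDiag)) :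
    ∏ j, entryMoment m (endpointCount f j) (x j) = 0 ∨
    (2 ≤ #(vertexSupport f) ∧ #(vertexSupport f) ≤ d ∧
      ∏ j, entryMoment m (endpointCount f j) (x j)
        ≤ (1 / k) ^ d * ∏ j ∈ vertexSupport f, (k * x j ^ 2 / m)) := by
  by_cases hodd : ∃ j, ¬ Even (endpointCount f j)
  · obtain ⟨j, hj⟩ := hodd
    refine Or.inl (prod_eq_zero (mem_univ j) ?_)
    have : endpointCount f j ≠ 0 := fun h => hj (by simp [h])
    simp [entryMoment, hj, this]
  · push Not at hodd
    have hsum : ∑ j ∈ vertexSupport f, endpointCount f j = 2 * d := by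
      rw [← sum_endpointCount f]
      exact sum_filter_ne_zero _
    have hhalf : ∑ j ∈ vertexSupport f, endpointCount f j / 2 = d := by
      have : ∑ j ∈ vertexSupport f, 2 * (endpointCount f j / 2) = 2 * d := by
        rw [← hsum]
        exact sum_congr rfl fun j _ => Nat.two_mul_div_two_of_even (hodd j)
      rw [← mul_sum] at this
      omega
    have hmem : ∀ j ∈ vertexSupport f, endpointCount f j ≠ 0 := fun j hj =>
      (mem_filter.1 hj).2
    refine Or.inr ⟨?_, ?_, ?_⟩
    · have h0 := Fintype.mem_piFinset.1 hf ⟨0, hd⟩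
      rw [mem_offDiag] at h0
      have : ({(f ⟨0, hd⟩).1, (f ⟨0, hd⟩).2} : Finset (Fin n)) ⊆ vertexSupport f := by
        intro j hj
        rw [mem_insert, mem_singleton] at hj
        unfold vertexSupport
        rw [mem_filter]
        refine ⟨mem_univ _, ?_⟩
        rcases hj with rfl | rfl
        · exact endpointCount_fst_ne_zero f _
        · exact endpointCount_snd_ne_zero f _
      rw [← card_pair h0.2.2]
      exact card_le_card this
    · refine le_of_le_of_eq ?_ hhalf
      rw [card_eq_sum_ones]
      refine sum_le_sum fun j hj => ?_
      have h1 := hmem j hj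
      obtain ⟨a, ha⟩ := hodd j
      omega
    · calc ∏ j, entryMoment m (endpointCount f j) (x j)
          = ∏ j ∈ vertexSupport f, entryMoment m (endpointCount f j) (x j) := by
            refine (prod_subset (subset_univ _) fun j _ hj => ?_).symm
            have : endpointCount f j = 0 := by
              by_contra h
              exact hj (mem_filter.2 ⟨mem_univ _, h⟩)
            simp [this, entryMoment]
        _ ≤ ∏ j ∈ vertexSupport f, (k * x j ^ 2 / m * (1 / k) ^ (endpointCount f j / 2)) :=
            prod_le_prod (fun j _ => entryMoment_nonneg _ _ _) fun j hj =>
              entryMoment_le hm hk (hx j) (hmem j hj) (hodd j)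
        _ = _ := by rw [prod_mul_distrib, prod_pow_eq_pow_sum, hhalf, mul_comm]

theorem card_vertexSupport_fiber_le {ι : Type*} [DecidableEq ι] [Fintype ι] {d : ℕ}
    (S : Finset (Fin d → ι × ι)) (V : Finset ι) :
    #(S.filter fun f => vertexSupport f = V) ≤ (#V ^ 2) ^ d := by
  have : S.filter (fun f => vertexSupport f = V)
      ⊆ Fintype.piFinset (fun _ : Fin d => V ×ˢ V) := by
    intro f hf
    have hV := (mem_filter.1 hf).2
    rw [Fintype.mem_piFinset]
    intro t
    rw [mem_product, ← hV]
    exact ⟨mem_filter.2 ⟨mem_univ _, endpointCount_fst_ne_zero f t⟩,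
      mem_filter.2 ⟨mem_univ _, endpointCount_snd_ne_zero f t⟩⟩
  refine (card_le_card this).trans ?_
  simp [Fintype.card_piFinset, sq]

theorem bucketMoment_le {m n d : ℕ} (hm : 0 < m) (hd : 0 < d) {k T r : ℝ} (hk : 0 < k)
    (hT : 0 < T) (hr : 0 < r) {x : Fin n → ℝ} (hx : ∀ j, x j ^ 2 ≤ 1 / k) (hx1 : ∑ j, x j ^ 2 = 1)
    (hb : ∀ v : ℕ, 2 ≤ v → v ≤ d →
      (T * v ^ 2 / (d * k)) ^ d ≤ 36 ^ d * (r / m) * (m * v / k) ^ v) :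
    bucketMoment m x d ≤ (36 * Real.exp 1 * d / T) ^ d * (r / m) := by
  have hm' : (0 : ℝ) < m := by exact_mod_cast hm
  have hd' : (0 : ℝ) < d := by exact_mod_cast hd
  set S := Fintype.piFinset (fun _ : Fin d => (univ : Finset (Fin n)).offDiag) with hS
  have hfib : ∀ V : Finset (Fin n),
      ∑ f ∈ S.filter (fun f => vertexSupport f = V),
        ∏ j, entryMoment m (endpointCount f j) (x j)
      ≤ (36 * d / T) ^ d * (r / m) * ∏ j ∈ V, (d * x j ^ 2) := by
    intro V
    have hR : 0 ≤ (36 * d / T) ^ d * (r / m) * ∏ j ∈ V, (d * x j ^ 2) :=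
      mul_nonneg (by positivity) (prod_nonneg fun _ _ => by positivity)
    by_cases hV : 2 ≤ #V ∧ #V ≤ d
    · have hP : 0 ≤ ∏ j ∈ V, (k * x j ^ 2 / m) := prod_nonneg fun _ _ => by positivity
      have hv0 : (0 : ℝ) < #V := by exact_mod_cast (by omega : 0 < #V)
      calc ∑ f ∈ S.filter (fun f => vertexSupport f = V),
            ∏ j, entryMoment m (endpointCount f j) (x j)
          ≤ ∑ f ∈ S.filter (fun f => vertexSupport f = V),
            (1 / k) ^ d * ∏ j ∈ V, (k * x j ^ 2 / m) := by
            refine sum_le_sum fun f hf => ?_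
            obtain ⟨hfS, hfV⟩ := mem_filter.1 hf
            rcases prod_entryMoment_le hm hd hk hx hfS with h | h
            · rw [h]; positivity
            · rw [← hfV]; exact h.2.2
        _ = #(S.filter fun f => vertexSupport f = V) *
            ((1 / k) ^ d * ∏ j ∈ V, (k * x j ^ 2 / m)) := by rw [sum_const, nsmul_eq_mul]
        _ ≤ ((#V : ℝ) ^ 2) ^ d * ((1 / k) ^ d * ∏ j ∈ V, (k * x j ^ 2 / m)) := by
            gcongr
            exact_mod_cast card_vertexSupport_fiber_le S V
        _ = (d / T) ^ d * (T * #V ^ 2 / (d * k)) ^ d * ∏ j ∈ V, (k * x j ^ 2 / m) := by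
            rw [← mul_assoc, ← mul_pow, ← mul_pow]
            congr 2
            field_simp
        _ ≤ (d / T) ^ d * (36 ^ d * (r / m) * (m * #V / k) ^ #V) *
              ∏ j ∈ V, (k * x j ^ 2 / m) := by
            gcongr
            exact hb _ hV.1 hV.2
        _ = (36 * d / T) ^ d * (r / m) * ∏ j ∈ V, (#V * x j ^ 2) := by
            have e : ∏ j ∈ V, (#V * x j ^ 2)
                = (m * #V / k) ^ #V * ∏ j ∈ V, (k * x j ^ 2 / m) := by
              rw [← prod_const, ← prod_mul_distrib]
              refine prod_congr rfl fun j _ => ?_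
              field_simp
            have e2 : (36 * d / T) ^ d = 36 ^ d * (d / T) ^ d := by
              rw [← mul_pow]; congr 1; ring
            rw [e, e2]
            ring
        _ ≤ _ := by
            gcongr with j hj
            · exact hV.2
    · refine le_trans (le_of_eq (sum_eq_zero fun f hf => ?_)) hR
      obtain ⟨hfS, hfV⟩ := mem_filter.1 hf
      rcases prod_entryMoment_le hm hd hk hx hfS with h | h
      · exact h
      · rw [hfV] at h
        exact absurd ⟨h.1, h.2.1⟩ hV
  calc bucketMoment m x d
      = ∑ V, ∑ f ∈ S.filter (fun f => vertexSupport f = V),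
          ∏ j, entryMoment m (endpointCount f j) (x j) := (sum_fiberwise _ _ _).symm
    _ ≤ ∑ V, (36 * d / T) ^ d * (r / m) * ∏ j ∈ V, (d * x j ^ 2) := sum_le_sum fun V _ => hfib V
    -- The sum over all supports factors over coordinates.
    _ = (36 * d / T) ^ d * (r / m) * ∏ j, (1 + d * x j ^ 2) := by
        rw [← mul_sum, prod_one_add, powerset_univ]
    _ ≤ (36 * d / T) ^ d * (r / m) * Real.exp (∑ j, d * x j ^ 2) := by
        gcongr
        exact Real.prod_one_add_le_exp_sum _ fun j => by positivity
    _ = _ := by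
        rw [← mul_sum, hx1]
        have e : (36 * Real.exp 1 * d / T) ^ d = (36 * d / T) ^ d * Real.exp 1 ^ d := by
          rw [← mul_pow]; congr 1; ring
        rw [e, ← Real.exp_nat_mul]
        ring

/-! ### Summing the generating function and returning to the distortion. -/

theorem bucketMoment_zero (m : ℕ) {n : ℕ} (x : Fin n → ℝ) : bucketMoment m x 0 = 1 := by
  simp [bucketMoment, endpointCount, entryMoment]

/-- With `t = 1 / (2 e a)`, the bound `d^d / d! ≤ e^d` makes the terms with `d ≥ 1` at most `2^(-d)
q`. -/
theorem sum_pow_mul_le {M : ℕ → ℝ} {a q : ℝ} (ha : 0 < a) (hq : 0 ≤ q) (h0 : M 0 = 1) (r : ℕ)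
    (hM : ∀ d, 0 < d → d ≤ r → M d ≤ (a * d) ^ d * q) :
    ∑ d ∈ range (r + 1), (1 / (2 * Real.exp 1 * a)) ^ d * M d / d.factorial ≤ 1 + q := by
  rw [sum_range_succ']
  have hterm : ∀ d ∈ range r, (1 / (2 * Real.exp 1 * a)) ^ (d + 1) * M (d + 1) /
      (d + 1).factorial ≤ (1 / 2) ^ d * (q / 2) := by
    intro d hd
    have hd' := hM (d + 1) (by omega) (by have := mem_range.1 hd; omega)
    calc (1 / (2 * Real.exp 1 * a)) ^ (d + 1) * M (d + 1) / (d + 1).factorial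
        ≤ (1 / (2 * Real.exp 1 * a)) ^ (d + 1) * ((a * (d + 1 : ℕ)) ^ (d + 1) * q) /
          (d + 1).factorial := by gcongr
      _ = (1 / 2) ^ (d + 1) * q / Real.exp 1 ^ (d + 1) *
          (((d + 1 : ℕ) : ℝ) ^ (d + 1) / (d + 1).factorial) := by
          have e : (1 / (2 * Real.exp 1 * a)) ^ (d + 1) * (a * (d + 1 : ℕ)) ^ (d + 1)
            = (1 / 2) ^ (d + 1) / Real.exp 1 ^ (d + 1) * ((d + 1 : ℕ) : ℝ) ^ (d + 1) := by
            rw [← div_pow, ← mul_pow, ← mul_pow]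
            congr 1
            field_simp
          rw [← mul_assoc, e]
          ring
      _ ≤ (1 / 2) ^ (d + 1) * q / Real.exp 1 ^ (d + 1) * Real.exp (d + 1 : ℕ) := by
          gcongr
          exact Real.pow_div_factorial_le_exp _ (by positivity) _
      _ = (1 / 2) ^ d * (q / 2) := by
          rw [← Real.exp_nat_mul, mul_one]
          field_simp
          ring
  have hg := sum_geometric_two_le r
  have : ∑ d ∈ range r, (1 / 2 : ℝ) ^ d * (q / 2) ≤ 2 * (q / 2) := by
    rw [← sum_mul]; gcongr
  have h2 := (sum_le_sum hterm).trans this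
  simp only [h0, pow_zero, Nat.factorial_zero, Nat.cast_one, mul_one, div_one]
  linarith

theorem distortion_eq {m n : ℕ} (x : EuclideanSpace ℝ (Fin n)) (ω : Sample m n) :
    distortion x ω = |∑ b, ∑ p ∈ univ.offDiag, entry x.ofLp ω b p.1 * entry x.ofLp ω b p.2| := by
  unfold distortion
  congr 1
  rw [EuclideanSpace.real_norm_sq_eq, EuclideanSpace.real_norm_sq_eq]
  have h1 : ∀ b, (hashMatrix ω).mulVec x.ofLp b = ∑ j, entry x.ofLp ω b j := by
    intro b
    simp [hashMatrix, entry, Matrix.mulVec, dotProduct]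
  have h2 : ∑ j, x.ofLp j ^ 2 = ∑ b, ∑ j, entry x.ofLp ω b j * entry x.ofLp ω b j := by
    rw [sum_comm]
    refine sum_congr rfl fun j _ => ?_
    have hs : (((ω.2 j : ℤˣ) : ℤ) : ℝ) * ((ω.2 j : ℤ) : ℝ) = 1 := by
      rcases Int.units_eq_one_or (ω.2 j) with h | h <;> simp [h]
    simp only [entry, mul_ite, ite_mul, zero_mul, mul_zero]
    rw [sum_eq_single (ω.1 j)]
    · simp only [if_true]
      linear_combination (-(x.ofLp j ^ 2)) * hs
    · intro b _ hb
      simp [hb.symm]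
    · simp
  simp only [h1]
  rw [h2, ← sum_sub_distrib]
  refine sum_congr rfl fun b _ => ?_
  rw [sq, sum_mul_sum, ← sum_product', ← diag_union_offDiag, sum_union (disjoint_diag_offDiag _),
    sum_diag]
  ring

theorem integral_sampleMeasure {m n : ℕ} (hm : 0 < m) (F : Sample m n → ℝ) :
    ∫ ω, F ω ∂(sampleMeasure m n) = (∑ ω, F ω) / (2 * m) ^ n := by
  have : Nonempty (Fin m) := ⟨⟨0, hm⟩⟩
  have h1 : IsProbabilityMeasure (uniformOn (Set.univ : Set (Fin n → Fin m))) :=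
    isProbabilityMeasure_uniformOn Set.finite_univ Set.univ_nonempty
  have h2 : IsProbabilityMeasure (uniformOn (Set.univ : Set (Fin n → ℤˣ))) :=
    isProbabilityMeasure_uniformOn Set.finite_univ Set.univ_nonempty
  have : IsProbabilityMeasure (sampleMeasure m n) := by
    unfold sampleMeasure; infer_instance
  rw [integral_fintype .of_finite, sum_div]
  refine sum_congr rfl fun ω _ => ?_
  have : (sampleMeasure m n).real {ω} = 1 / (2 * m) ^ n := by
    obtain ⟨h, σ⟩ := ω
    rw [← Set.singleton_prod_singleton, sampleMeasure, measureReal_prod_prod]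
    simp [Measure.real, uniformOn_univ, mul_pow]
  rw [this, smul_eq_mul]
  ring

/-- The `m`-th power of the generating function is at most `(1 + r / m)^m ≤ e^r`, and `r! ≤ r^r`; so
the base is `r · 2 e a · e` with `a = 36 e / T`. -/
theorem sum_distortion_pow_le {m n r : ℕ} (hm : 0 < m) (hr : 0 < r) {T : ℝ} (hT : 0 < T)
    (x : Fin n → ℝ)
    (hM : ∀ d, 0 < d → d ≤ r → bucketMoment m x d ≤ (36 * Real.exp 1 * d / T) ^ d * (r / m)) :
    (∑ ω : Sample m n, (∑ b, ∑ p ∈ univ.offDiag, entry x ω b p.1 * entry x ω b p.2) ^ r)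
      / (2 * m) ^ n ≤ (72 * Real.exp 1 ^ 3 * (r / T)) ^ r := by
  have hm' : (0 : ℝ) < m := by exact_mod_cast hm
  set a := 36 * Real.exp 1 / T with ha
  have ha0 : 0 < a := by positivity
  have hS := sum_pow_mul_le (M := bucketMoment m x) (q := r / m) ha0 (by positivity)
    (bucketMoment_zero m x) r (fun d h1 h2 => by
      refine (hM d h1 h2).trans_eq ?_
      congr 2
      rw [ha]; ring)
  rw [div_le_iff₀' (by positivity)]
  refine (sum_offDiag_pow_le hm x r).trans ?_
  gcongr
  refine (sum_multinomial_le (bucketMoment_nonneg m x)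
    (by positivity : 0 < 1 / (2 * Real.exp 1 * a)) r).trans ?_
  calc r.factorial / (1 / (2 * Real.exp 1 * a)) ^ r *
        (∑ d ∈ range (r + 1), (1 / (2 * Real.exp 1 * a)) ^ d * bucketMoment m x d /
          d.factorial) ^ m
      ≤ (r : ℝ) ^ r / (1 / (2 * Real.exp 1 * a)) ^ r * Real.exp (r / m) ^ m := by
        have hnn : 0 ≤ ∑ d ∈ range (r + 1), (1 / (2 * Real.exp 1 * a)) ^ d *
            bucketMoment m x d / d.factorial := sum_nonneg fun d _ => by
          have := bucketMoment_nonneg m x d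
          positivity
        gcongr
        · exact_mod_cast Nat.factorial_le_pow r
        · refine hS.trans ?_
          linarith [Real.add_one_le_exp ((r : ℝ) / m)]
    _ = (r : ℝ) ^ r / (1 / (2 * Real.exp 1 * a)) ^ r * Real.exp 1 ^ r := by
        rw [← Real.exp_nat_mul, ← Real.exp_nat_mul]
        congr 2
        field_simp
    _ = (72 * Real.exp 1 ^ 3 * (r / T)) ^ r := by
        rw [← div_pow, ← mul_pow]
        congr 1
        rw [ha]
        field_simp
        ring

end FeatureHashing

theorem lemma2 :
    ∃ C : ℝ, 0 < C ∧
      ∀ (m n r : ℕ), 0 < r → Even r → (r : ℝ) ≤ (m : ℝ) / 4 →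
        ∀ x : EuclideanSpace ℝ (Fin n), ‖x‖ = 1 →
          FeatureHashing.momentNorm (FeatureHashing.sampleMeasure m n)
              (FeatureHashing.distortion x) (r : ℝ)
            ≤ C * FeatureHashing.Lam (m : ℝ) (r : ℝ) ((FeatureHashing.supNorm x) ^ (-2 : ℤ)) := by
  -- The 36 comes from `support_bound` and the 2 from the geometric series. The three factors `e`
  -- come from `∏ (1 + d x_j²)`, `d^d / d!` and `(1 + r / m)^m`.
  refine ⟨72 * Real.exp 1 ^ 3, by positivity, ?_⟩
  intro m n r hr he hrm x hx
  have hr' : (1 : ℝ) ≤ r := by exact_mod_cast hr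
  have hr0 : (0 : ℝ) < r := by linarith
  have hm' : (0 : ℝ) < m := by linarith
  have hrm' : (r : ℝ) ≤ m := by linarith
  have hm : 0 < m := by exact_mod_cast hm'
  have hx0 : x.ofLp ≠ 0 := by
    intro h
    have : x = 0 := by ext j; simp [h]
    simp [this] at hx
  have hs : 0 < FeatureHashing.supNorm x := norm_pos_iff.2 hx0
  set k := (FeatureHashing.supNorm x) ^ (-2 : ℤ) with hkdef
  have hk : 0 < k := by positivity
  have hk1 : 1 / k = FeatureHashing.supNorm x ^ 2 := by
    rw [hkdef, zpow_neg, one_div, inv_inv]; norm_cast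
  have hxk : ∀ j, x.ofLp j ^ 2 ≤ 1 / k := by
    intro j
    rw [hk1, ← sq_abs]
    gcongr
    exact norm_le_pi_norm x.ofLp j
  have hx1 : ∑ j, x.ofLp j ^ 2 = 1 := by
    rw [← EuclideanSpace.real_norm_sq_eq, hx, one_pow]
  obtain ⟨hL, hb1, hb2, hb3⟩ := FeatureHashing.Lam_bounds hm' hr0 hk
  set Λ := FeatureHashing.Lam m r k
  have hT : 0 < r / Λ := by positivity
  have hM : ∀ d, 0 < d → d ≤ r → FeatureHashing.bucketMoment m x.ofLp d
      ≤ (36 * Real.exp 1 * d / (r / Λ)) ^ d * (r / m) := fun d hd hdr =>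
    FeatureHashing.bucketMoment_le hm hd hk hT hr0 hxk hx1 fun v hv hvd =>
      FeatureHashing.support_bound hT hm' hr0 hk hrm' hb1 hb2 (fun h => hb3 h hrm' hr') hv hvd
        (by exact_mod_cast hdr)
  have hmain := FeatureHashing.sum_distortion_pow_le hm hr hT x.ofLp hM
  have hΛ : r / (r / Λ) = Λ := by field_simp
  rw [hΛ] at hmain
  have hint : ∫ ω, |FeatureHashing.distortion x ω| ^ (r : ℝ) ∂(FeatureHashing.sampleMeasure m n)
      ≤ (72 * Real.exp 1 ^ 3 * Λ) ^ r := by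
    rw [FeatureHashing.integral_sampleMeasure hm]
    refine le_of_eq_of_le ?_ hmain
    congr 1
    refine Finset.sum_congr rfl fun ω _ => ?_
    rw [Real.rpow_natCast, FeatureHashing.distortion_eq, abs_abs, he.pow_abs]
  unfold FeatureHashing.momentNorm
  calc (∫ ω, |FeatureHashing.distortion x ω| ^ (r : ℝ) ∂(FeatureHashing.sampleMeasure m n))
        ^ (1 / (r : ℝ))
      ≤ ((72 * Real.exp 1 ^ 3 * Λ) ^ r) ^ (1 / (r : ℝ)) :=
        Real.rpow_le_rpow (MeasureTheory.integral_nonneg fun ω => by positivity) hint (by positivity)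
    _ = 72 * Real.exp 1 ^ 3 * Λ := by
        rw [one_div, Real.pow_rpow_inv_natCast (by positivity) hr.ne']
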